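/- Let $n\ge 1$, $p\ge 0$, let $X\in\mathbb{R}^{n\times p}$ be deterministic, $\beta^*\in\mathbb{R}^p$, and $Y=X\beta^*+\varepsilon$, where $\varepsilon_1,\dots,\varepsilon_n$ are independent $\mathcal N(0,\sigma^2)$ variables, $\sigma>0$. Fix $\mu\ge 0$ and $\lambda>0$. For $y\in\mathbb{R}^n$, an S-Lasso estimate is a minimizer over $\beta\in\mathbb{R}^p$ of $$\frac1n\sum_{i=1}^n\bigl(y_i-(X\beta)_i\bigr)^2+\lambda\sum_{j=1}^p|\beta_j|+\mu\sum_{j=2}^p(\beta_j-\beta_{j-1})^2 .$$ Let $\widetilde J=\mathbf J'\mathbf J$, where $\mathbf J$ is the $p\times p$ matrix whose first row is zero and whose row $i\ge 2$ has entry $1$ in column $i-1$, entry $-1$ in column $i$ and zeros elsewhere, so that $\beta'\widetilde J\beta=\sum_{j=2}^p(\beta_j-\beta_{j-1})^2$. For $A\subseteq\{1,\dots,p\}$ let $X_{\cdot,A}$ be the matrix of the columns of $X$ with index in $A$, $\widetilde J_{A,A}$ the corresponding principal submatrix of $\widetilde J$, and $G_A=X_{\cdot,A}'X_{\cdot,A}+n\mu\,\widetilde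 J_{A,A}$. (i) If $b$ is the unique S-Lasso estimate for $y$ and $A=\{j: b_j\ne 0\}$ is its active set, then $G_A$ is invertible. (ii) For each $y$ let $\hat\beta(y)$ be an S-Lasso estimate for $y$ with active set $\mathcal A(y)=\{j:\hat\beta_j(y)\neq 0\}$, and suppose that $G_{\mathcal A(Y)}$ is almost surely invertible (by (i), this is automatic if the estimate is unique). Then the fit $\hat y=X\hat\beta(Y)$ is square integrable and $$\widehat{\mathrm{df}}=\mathrm{Tr}\Bigl[X_{\cdot,\mathcal A(Y)}\bigl(X_{\cdot,\mathcal A(Y)}'X_{\cdot,\mathcal A(Y)}+n\mu\,\widetilde J_{\mathcal A(Y),\mathcal A(Y)}\bigr)^{-1}X_{\cdot,\mathcal A(Y)}'\Bigr]$$ is integrable and is an unbiased estimator of the effective degrees of freedom of the S-Lasso fit: $$\mathbb E\bigl[\widehat{\mathrm{df}}\bigr]=\mathrm{df}(\hat y):=\frac1{\sigma^2}\sum_{i=1}^n\mathrm{Cov}(Y_i,\hat y_i).$$ -/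

import Mathlib

open MeasureTheory ProbabilityTheory
open scoped Matrix NNReal

namespace SLasso

/-- The squared empirical norm `‖a‖ₙ² = n⁻¹ ∑ᵢ aᵢ²`. -/
noncomputable def empNormSq {n : ℕ} (a : Fin n → ℝ) : ℝ :=
  (n : ℝ)⁻¹ * ∑ i, a i ^ 2

/-- The `ℓ²`-fusion term: the sum of `(βⱼ - βₖ)²` over the pairs of consecutive indices
`k + 1 = j`. -/
noncomputable def fusion {p : ℕ} (β : Fin p → ℝ) : ℝ :=
  ∑ j : Fin p, ∑ k : Fin p, if (k : ℕ) + 1 = (j : ℕ) then (β j - β k) ^ 2 else 0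

/-- The S-Lasso criterion
`‖y - Xβ‖ₙ² + lam * |β|₁ + mu * ∑_{j ≥ 2} (βⱼ - βⱼ₋₁)²`. -/
noncomputable def criterion {n p : ℕ} (X : Matrix (Fin n) (Fin p) ℝ) (lam mu : ℝ)
    (y : Fin n → ℝ) (β : Fin p → ℝ) : ℝ :=
  empNormSq (y - X *ᵥ β) + lam * ∑ j, |β j| + mu * fusion β

/-- `b` is an S-Lasso estimate for the response `y`: a global minimizer of the criterion. -/
def IsEstimate {n p : ℕ} (X : Matrix (Fin n) (Fin p) ℝ) (lam mu : ℝ)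
    (y : Fin n → ℝ) (b : Fin p → ℝ) : Prop :=
  ∀ β : Fin p → ℝ, criterion X lam mu y b ≤ criterion X lam mu y β

/-- The `p × p` first-difference matrix: its first row is zero and row `i ≥ 2` has entry `1`
in column `i - 1`, entry `-1` in column `i` and zeros elsewhere. -/
def diffMatrix (p : ℕ) : Matrix (Fin p) (Fin p) ℝ :=
  Matrix.of fun i j =>
    if (j : ℕ) + 1 = (i : ℕ) then 1 else if j = i ∧ 0 < (i : ℕ) then -1 else 0

/-- `J̃ = J' J`. -/
def Jtilde (p : ℕ) : Matrix (Fin p) (Fin p) ℝ :=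
  (diffMatrix p)ᵀ * diffMatrix p

/-- The active set of a coefficient vector: the indices of its non-zero entries. -/
noncomputable def activeSet {p : ℕ} (b : Fin p → ℝ) : Finset (Fin p) :=
  Finset.univ.filter fun j => b j ≠ 0

/-- `X_{., A}`: the columns of `X` with index in `A`. -/
def colSub {n p : ℕ} (X : Matrix (Fin n) (Fin p) ℝ) (A : Finset (Fin p)) :
    Matrix (Fin n) A ℝ :=
  X.submatrix id Subtype.val

/-- `X_{., A}' X_{., A} + n * mu * J̃_{A, A}`. -/
noncomputable def activeGram {n p : ℕ} (X : Matrix (Fin n) (Fin p) ℝ) (mu : ℝ)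
    (A : Finset (Fin p)) : Matrix A A ℝ :=
  (colSub X A)ᵀ * colSub X A +
    ((n : ℝ) * mu) • (Jtilde p).submatrix Subtype.val Subtype.val

/-- The estimate of the degrees of freedom attached to an active set `A`:
`Tr [X_{., A} (X_{., A}' X_{., A} + n * mu * J̃_{A, A})⁻¹ X_{., A}']`. -/
noncomputable def dfHat {n p : ℕ} (X : Matrix (Fin n) (Fin p) ℝ) (mu : ℝ)
    (A : Finset (Fin p)) : ℝ :=
  (colSub X A * (activeGram X mu A)⁻¹ * (colSub X A)ᵀ).trace

/-- The response vector of the linear model with design `X`, coefficients `βstar`, noise `ε`. -/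
noncomputable def response {Ω : Type*} {n p : ℕ} (X : Matrix (Fin n) (Fin p) ℝ)
    (βstar : Fin p → ℝ) (ε : Fin n → Ω → ℝ) (ω : Ω) : Fin n → ℝ :=
  fun i => (X *ᵥ βstar) i + ε i ω

/-- The effective degrees of freedom `σ⁻² ∑ᵢ Cov(Yᵢ, ŷᵢ)` of a fit `ŷ` of the random
response `Y` with noise level `σ`. -/
noncomputable def effectiveDF {Ω : Type*} [MeasurableSpace Ω] {n : ℕ} (P : Measure Ω)
    (σ : ℝ) (Y yhat : Ω → Fin n → ℝ) : ℝ :=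
  (σ ^ 2)⁻¹ * ∑ i, cov[fun ω => Y ω i, fun ω => yhat ω i; P]

end SLasso

/-!
The proof rests on Stein's identity: if `g` is a Lipschitz function of a Gaussian vector `Y` with
independent coordinates of variance `σ²`, then `Cov (Yᵢ, g Y) = σ² E[∂ᵢ g (Y)]`. Summed over the
coordinates of the fit, it turns the effective degrees of freedom into the expected divergence of
the fit `y ↦ X βhat(y)`.

The fit is Lipschitz, because the criterion is strongly convex in `X β`
(`SLasso.lipschitzWith_fit`); hence it is measurable and, by Rademacher's theorem, differentiable
almost everywhere. Writing `G_A` for the Gram matrix `activeGram X mu A`, the stationarity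
conditions on the active set `A` (`SLasso.IsEstimate.activeGram_mulVec_eq`) show that wherever
`G_A` is invertible the fit equals `X_A G_A⁻¹ X_A' y` plus a vector that depends only on `A` and on
the signs of the coefficients (`SLasso.IsEstimate.fit_eq`).
So the fit agrees with one of finitely many affine maps, and at almost every point where a Lipschitz
map agrees with an affine one their derivatives agree
(`LipschitzWith.ae_fderiv_eq_of_eq_affine`). The divergence is therefore almost everywhere
the trace of `X_A G_A⁻¹ X_A'` (`SLasso.ae_dfHat_eq_sum_lineDeriv`). This needs neither the local
constancy of the active set nor the measurability of the selection `βhat`.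

For the invertibility of `G_A` under uniqueness: a vector in the kernel of `G_A` leaves the fit
and, if `mu > 0`, the fusion term unchanged, and since the criterion is stationary along it with
constant signs, moving a little along it yields another minimizer.
-/

/-! ### Gaussian integration by parts -/

open Filter Topology in
theorem tendsto_mul_gaussianPDFReal_of_lipschitz {f : ℝ → ℝ} {K : ℝ≥0} (hf : LipschitzWith K f)
    {v : ℝ≥0} (hv : v ≠ 0) :
    Tendsto (fun x => f x * gaussianPDFReal 0 v x) (cocompact ℝ) (𝓝 0) := by
  have ha : (0 : ℝ) < (2 * (v : ℝ))⁻¹ := by positivity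
  have h0 := tendsto_rpow_abs_mul_exp_neg_mul_sq_cocompact ha 0
  have h1 := tendsto_rpow_abs_mul_exp_neg_mul_sq_cocompact ha 1
  have hlim := ((h0.const_mul |f 0|).add (h1.const_mul (K : ℝ))).const_mul
    (√(2 * Real.pi * v))⁻¹
  simp only [mul_zero, add_zero] at hlim
  refine squeeze_zero_norm (fun x => ?_) hlim
  have hfx : |f x| ≤ |f 0| + K * |x| := by
    have h := hf.dist_le_mul x 0
    simp only [Real.dist_eq, sub_zero] at h
    have := abs_sub_abs_le_abs_sub (f x) (f 0)
    linarith
  have hexp : -(x - 0) ^ 2 / (2 * (v : ℝ)) = -(2 * (v : ℝ))⁻¹ * x ^ 2 := by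
    field_simp
    simp
  rw [norm_mul, Real.norm_of_nonneg (gaussianPDFReal_nonneg _ _ _), Real.norm_eq_abs,
    gaussianPDFReal_def, Real.rpow_zero, Real.rpow_one]
  simp only [hexp]
  calc |f x| * ((√(2 * Real.pi * v))⁻¹ * Real.exp (-(2 * (v : ℝ))⁻¹ * x ^ 2))
      ≤ (|f 0| + K * |x|) * ((√(2 * Real.pi * v))⁻¹ * Real.exp (-(2 * (v : ℝ))⁻¹ * x ^ 2)) := by
        gcongr
    _ = _ := by ring

theorem hasDerivAt_gaussianPDFReal {v : ℝ≥0} (hv : v ≠ 0) (x : ℝ) :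
    HasDerivAt (gaussianPDFReal 0 v) (-((v : ℝ)⁻¹ * (x * gaussianPDFReal 0 v x))) x := by
  have hv' : (v : ℝ) ≠ 0 := by exact_mod_cast hv
  have h : HasDerivAt (fun x : ℝ => -(x - 0) ^ 2 / (2 * (v : ℝ))) (-((v : ℝ)⁻¹ * x)) x := by
    refine (((((hasDerivAt_id x).sub_const 0).pow 2).neg).div_const (2 * (v : ℝ))).congr_deriv ?_
    simp
    field_simp
  refine ((h.exp).const_mul (√(2 * Real.pi * v))⁻¹).congr_deriv ?_
  rw [gaussianPDFReal_def]
  ring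

theorem LipschitzWith.memLp_comp {α E F : Type*} [NormedAddCommGroup E] [MeasurableSpace α]
    [NormedAddCommGroup F] {μ : Measure α} [IsFiniteMeasure μ] {g : E → F} {K : ℝ≥0}
    (hg : LipschitzWith K g) {f : α → E} {q : ENNReal} (hf : MemLp f q μ) :
    MemLp (fun x => g (f x)) q μ := by
  have h1 : LipschitzWith K (fun x => g x - g 0) := fun x y => by simpa using hg x y
  have h2 := (h1.comp_memLp (by simp) hf).add (memLp_const (g 0))
  convert! h2 using 1
  ext x
  simp

theorem integrable_gaussianReal_iff {v : ℝ≥0} (hv : v ≠ 0) {f : ℝ → ℝ} :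
    Integrable f (gaussianReal 0 v) ↔ Integrable (fun x => gaussianPDFReal 0 v x * f x) := by
  rw [gaussianReal_of_var_ne_zero _ hv, integrable_withDensity_iff_integrable_smul'
    (measurable_gaussianPDF _ _) (ae_of_all _ fun _ => gaussianPDF_lt_top)]
  simp


open Filter Topology in
/-- Gaussian integration by parts (Stein's identity) on the line. -/
theorem integral_id_mul_gaussianReal_of_lipschitz {f : ℝ → ℝ} {K : ℝ≥0} (hf : LipschitzWith K f)
    {v : ℝ≥0} (hv : v ≠ 0) :
    ∫ x, x * f x ∂gaussianReal 0 v = v * ∫ x, deriv f x ∂gaussianReal 0 v := by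
  have hv' : (v : ℝ) ≠ 0 := by exact_mod_cast hv
  have hf2 : MemLp f 2 (gaussianReal 0 v) :=
    hf.memLp_comp (memLp_id_gaussianReal' 2 (by simp))
  have hxf : Integrable (fun x => x * f x) (gaussianReal 0 v) :=
    (memLp_id_gaussianReal' 2 (by simp)).integrable_mul hf2
  have hdf : Integrable (deriv f) (gaussianReal 0 v) :=
    (MemLp.of_bound (measurable_deriv f).aestronglyMeasurable K
      (ae_of_all _ fun x => norm_deriv_le_of_lipschitz hf)).integrable (le_refl (1 : ENNReal))
  have hderiv : deriv (gaussianPDFReal 0 v) =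
      fun x => -((v : ℝ)⁻¹ * (x * gaussianPDFReal 0 v x)) :=
    funext fun x => (hasDerivAt_gaussianPDFReal hv x).deriv
  have hsmooth : ContDiff ℝ 1 (gaussianPDFReal 0 v) := by
    rw [gaussianPDFReal_def]
    fun_prop
  have hparts : ∀ R : ℝ, ∫ x in (-R)..R,
      (deriv f x * gaussianPDFReal 0 v x + f x * deriv (gaussianPDFReal 0 v) x) =
        f R * gaussianPDFReal 0 v R - f (-R) * gaussianPDFReal 0 v (-R) := fun R => by
    obtain ⟨C, hC⟩ := hsmooth.contDiffOn.exists_lipschitzOnWith one_ne_zero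
      (convex_uIcc (-R) R) isCompact_uIcc
    exact (hf.lipschitzOnWith.absolutelyContinuousOnInterval).integral_deriv_mul_eq_sub
      hC.absolutelyContinuousOnInterval
  have hint1 : Integrable (fun x => deriv f x * gaussianPDFReal 0 v x) := by
    simpa only [mul_comm] using (integrable_gaussianReal_iff hv).1 hdf
  have hint2 : Integrable (fun x => f x * deriv (gaussianPDFReal 0 v) x) := by
    refine (((integrable_gaussianReal_iff hv).1 hxf).const_mul (-(v : ℝ)⁻¹)).congr
      (ae_of_all _ fun x => ?_)
    simp only [hderiv]
    ring
  have hlim1 := intervalIntegral_tendsto_integral (hint1.add hint2) tendsto_neg_atTop_atBot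
    tendsto_id
  have hbd := tendsto_mul_gaussianPDFReal_of_lipschitz hf hv
  rw [cocompact_eq_atBot_atTop] at hbd
  have hlim2 := (hbd.mono_left le_sup_right).sub
    ((hbd.mono_left le_sup_left).comp tendsto_neg_atTop_atBot)
  have hzero : ∫ x, (deriv f x * gaussianPDFReal 0 v x + f x * deriv (gaussianPDFReal 0 v) x)
      = 0 := by
    refine tendsto_nhds_unique hlim1 ?_
    rw [sub_zero] at hlim2
    exact hlim2.congr fun R => (hparts R).symm
  rw [integral_add hint1 hint2] at hzero
  rw [integral_gaussianReal_eq_integral_smul hv, integral_gaussianReal_eq_integral_smul hv]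
  have e1 : ∫ x, gaussianPDFReal 0 v x • deriv f x = ∫ x, deriv f x * gaussianPDFReal 0 v x := by
    simp only [smul_eq_mul, mul_comm]
  have e2 : ∫ x, f x * deriv (gaussianPDFReal 0 v) x =
      -(v : ℝ)⁻¹ * ∫ x, gaussianPDFReal 0 v x • (x * f x) := by
    rw [← integral_const_mul]
    refine integral_congr_ae (ae_of_all _ fun x => ?_)
    simp only [hderiv, smul_eq_mul]
    ring
  rw [e1]
  rw [e2] at hzero
  have := eq_neg_of_add_eq_zero_left hzero
  rw [this]
  field_simp

theorem lineDeriv_insertNth {k : ℕ} (i : Fin (k + 1)) (F : (Fin (k + 1) → ℝ) → ℝ) (t : ℝ)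
    (r : Fin k → ℝ) :
    lineDeriv ℝ F (i.insertNth t r : Fin (k + 1) → ℝ) (Pi.single i 1) =
      deriv (fun s => F (i.insertNth s r : Fin (k + 1) → ℝ)) t := by
  have h : ∀ s : ℝ, (i.insertNth t r : Fin (k + 1) → ℝ) + s • Pi.single i (1 : ℝ) =
      (i.insertNth (t + s) r : Fin (k + 1) → ℝ) := fun s => by
    ext j
    refine i.succAboveCases ?_ (fun l => ?_) j
    · simp
    · simp [Fin.succAbove_ne]
  simp only [lineDeriv, h]
  have := deriv_comp_const_add (fun s => F (i.insertNth s r : Fin (k + 1) → ℝ)) t 0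
  simpa using this

theorem memLp_id_pi_gaussianReal (n : ℕ) (v : ℝ≥0) :
    MemLp (fun z : Fin n → ℝ => z) 2 (Measure.pi fun _ => gaussianReal 0 v) := by
  rw [memLp_pi_iff]
  exact fun i => (memLp_id_gaussianReal' 2 (by simp)).comp_measurePreserving
    (measurePreserving_eval (fun _ : Fin n => gaussianReal 0 v) i)

theorem integrable_lineDeriv_of_lipschitz {n : ℕ} {F : (Fin n → ℝ) → ℝ} {K : ℝ≥0}
    (hF : LipschitzWith K F) (e : Fin n → ℝ) (μ : Measure (Fin n → ℝ)) [IsFiniteMeasure μ] :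
    Integrable (fun z => lineDeriv ℝ F z e) μ :=
  (hF.memLp_lineDeriv e).integrable le_top

/-- Stein's identity for a vector of independent centred Gaussians with common variance: the
one-dimensional identity in the coordinate `i`, integrated over the other coordinates. -/
theorem integral_eval_mul_pi_gaussianReal_of_lipschitz {n : ℕ} {F : (Fin n → ℝ) → ℝ} {K : ℝ≥0}
    (hF : LipschitzWith K F) {v : ℝ≥0} (hv : v ≠ 0) (i : Fin n) :
    ∫ z, z i * F z ∂Measure.pi (fun _ => gaussianReal 0 v) =
      v * ∫ z, lineDeriv ℝ F z (Pi.single i 1) ∂Measure.pi (fun _ => gaussianReal 0 v) := by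
  obtain ⟨k, rfl⟩ : ∃ k, n = k + 1 := Nat.exists_eq_succ_of_ne_zero (Fin.pos i).ne'
  have hmp := (measurePreserving_piFinSuccAbove
    (fun _ : Fin (k + 1) => gaussianReal 0 v) i).symm
  have hemb :=
    (MeasurableEquiv.piFinSuccAbove (fun _ : Fin (k + 1) => ℝ) i).symm.measurableEmbedding
  have hid := memLp_id_pi_gaussianReal (k + 1) v
  have hint1 : Integrable (fun z : Fin (k + 1) → ℝ => z i * F z)
      (Measure.pi fun _ => gaussianReal 0 v) :=
    (hid.eval i).integrable_mul (hF.memLp_comp hid)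
  have hint2 := integrable_lineDeriv_of_lipschitz hF (Pi.single i 1)
    (Measure.pi fun _ => gaussianReal 0 v)
  rw [← hmp.integrable_comp_emb hemb] at hint1 hint2
  simp only [Function.comp_def] at hint1 hint2
  rw [← hmp.integral_comp', ← hmp.integral_comp', integral_prod_symm _ hint1,
    integral_prod_symm _ hint2, ← integral_const_mul]
  refine integral_congr_ae (ae_of_all _ fun r => ?_)
  have hlip : LipschitzWith K (fun t : ℝ => F (i.insertNth t r : Fin (k + 1) → ℝ)) := by
    refine LipschitzWith.of_dist_le_mul fun s t => (hF.dist_le_mul _ _).trans ?_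
    gcongr
    refine (dist_pi_le_iff dist_nonneg).2 fun j => ?_
    refine i.succAboveCases ?_ (fun l => ?_) j
    · simp
    · simp
  have h1 := integral_id_mul_gaussianReal_of_lipschitz hlip hv
  simpa [MeasurableEquiv.piFinSuccAbove_symm_apply, Fin.insertNthEquiv, lineDeriv_insertNth]
    using h1

theorem pi_absolutelyContinuous {n : ℕ} {μ ν : Fin n → Measure ℝ} [∀ i, SigmaFinite (μ i)]
    [∀ i, SigmaFinite (ν i)] (h : ∀ i, μ i ≪ ν i) : Measure.pi μ ≪ Measure.pi ν := by
  induction n with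
  | zero => rw [Measure.pi_of_empty, Measure.pi_of_empty]
  | succ k ih =>
    have h1 := (measurePreserving_piFinSuccAbove μ 0).symm
    have h2 := (measurePreserving_piFinSuccAbove ν 0).symm
    rw [← h1.map_eq, ← h2.map_eq]
    exact ((h 0).prod (ih fun i => h _)).map h1.measurable

/-! ### Lipschitz maps that agree with an affine map -/

/-- Where a Lipschitz map agrees with an affine one, their derivatives agree almost everywhere:
they do at the Lebesgue density points of the agreement set. -/
theorem LipschitzWith.ae_fderiv_eq_of_eq_affine {E : Type*} [NormedAddCommGroup E]
    [NormedSpace ℝ E] [FiniteDimensional ℝ E] [MeasurableSpace E] [BorelSpace E] {μ : Measure E}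
    [μ.IsAddHaarMeasure] {g : E → E} {K : ℝ≥0} (hg : LipschitzWith K g) (L : E →L[ℝ] E) (c : E) :
    ∀ᵐ x ∂μ, g x = L x + c → HasFDerivAt g L x := by
  let s : Set E := {x | g x = L x + c} ∩ {x | DifferentiableAt ℝ g x}
  have hs : MeasurableSet s :=
    (isClosed_eq hg.continuous (by fun_prop)).measurableSet.inter
      (measurableSet_of_differentiableAt ℝ g)
  have happrox : ApproximatesLinearOn g L s 0 := fun x hx y hy => by
    have hx' : g x = L x + c := hx.1
    have hy' : g y = L y + c := hy.1
    simp [hx', hy']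
  have h := happrox.norm_fderiv_sub_le μ hs (fderiv ℝ g)
    fun x hx => (DifferentiableAt.hasFDerivAt hx.2).hasFDerivWithinAt
  rw [ae_restrict_iff' hs] at h
  filter_upwards [h, hg.ae_differentiableAt (μ := μ)] with x hx hd hxe
  have h0 : fderiv ℝ g x - L = 0 := by
    simpa using hx ⟨hxe, hd⟩
  rw [← sub_eq_zero.1 h0]
  exact hd.hasFDerivAt

/-! ### The two quadratic terms of the criterion -/

namespace SLasso

theorem fusion_eq_sum_sq_diffMatrix_mulVec {p : ℕ} (β : Fin p → ℝ) :
    fusion β = ∑ i, (diffMatrix p *ᵥ β) i ^ 2 := by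
  refine Finset.sum_congr rfl fun j _ => ?_
  simp only [Matrix.mulVec, dotProduct, diffMatrix, Matrix.of_apply]
  rcases Nat.eq_zero_or_pos (j : ℕ) with h0 | h0
  · simp [h0]
  · obtain ⟨k, hk⟩ : ∃ k : Fin p, (k : ℕ) + 1 = j :=
      ⟨⟨(j : ℕ) - 1, by omega⟩, by simp; omega⟩
    have hkj : k ≠ j := fun h => by simp [h] at hk
    have hiff : ∀ l : Fin p, (l : ℕ) + 1 = j ↔ l = k := fun l => by
      rw [Fin.ext_iff]
      omega
    have hentry : ∀ l : Fin p, (if l = k then (1 : ℝ) else if l = j ∧ 0 < (j : ℕ) then -1 else 0)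
        * β l = (if l = k then β l else 0) - if l = j then β l else 0 := fun l => by
      by_cases h1 : l = k
      · simp [h1, hkj]
      · by_cases h2 : l = j <;> simp [h1, h2, h0]
        simp [← h2, h1]
    simp only [hiff, hentry, Finset.sum_sub_distrib, Finset.sum_ite_eq', Finset.mem_univ, if_true]
    ring

theorem fusion_add_smul {p : ℕ} (b v : Fin p → ℝ) (t : ℝ) :
    fusion (b + t • v) =
      fusion b + t * (2 * ((diffMatrix p *ᵥ b) ⬝ᵥ (diffMatrix p *ᵥ v))) + t ^ 2 * fusion v := by
  simp only [fusion_eq_sum_sq_diffMatrix_mulVec, Matrix.mulVec_add, Matrix.mulVec_smul,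
    dotProduct, Finset.mul_sum, ← Finset.sum_add_distrib]
  refine Finset.sum_congr rfl fun i _ => ?_
  simp only [Pi.add_apply, Pi.smul_apply, smul_eq_mul]
  ring

theorem empNormSq_sub_smul {n : ℕ} (a d : Fin n → ℝ) (t : ℝ) :
    empNormSq (a - t • d) =
      empNormSq a - t * (2 * (n : ℝ)⁻¹ * (a ⬝ᵥ d)) + t ^ 2 * empNormSq d := by
  simp only [empNormSq, dotProduct, Finset.mul_sum, ← Finset.sum_add_distrib,
    ← Finset.sum_sub_distrib]
  refine Finset.sum_congr rfl fun i _ => ?_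
  simp only [Pi.sub_apply, Pi.smul_apply, smul_eq_mul]
  ring

theorem fusion_nonneg {p : ℕ} (β : Fin p → ℝ) : 0 ≤ fusion β := by
  rw [fusion_eq_sum_sq_diffMatrix_mulVec]
  positivity

theorem fusion_midpoint_le {p : ℕ} (b c : Fin p → ℝ) :
    fusion ((1 / 2 : ℝ) • (b + c)) ≤ (fusion b + fusion c) / 2 := by
  have h1 := fusion_add_smul b (c - b) 1
  have h2 := fusion_add_smul b (c - b) (1 / 2)
  have e1 : b + (1 : ℝ) • (c - b) = c := by simp
  have e2 : b + (1 / 2 : ℝ) • (c - b) = (1 / 2 : ℝ) • (b + c) := by module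
  rw [e1] at h1
  rw [e2] at h2
  have := fusion_nonneg (c - b)
  linarith

theorem empNormSq_midpoint {n : ℕ} (a c : Fin n → ℝ) :
    empNormSq ((1 / 2 : ℝ) • (a + c)) =
      (empNormSq a + empNormSq c) / 2 - empNormSq (a - c) / 4 := by
  have h1 := empNormSq_sub_smul a (a - c) 1
  have h2 := empNormSq_sub_smul a (a - c) (1 / 2)
  have e1 : a - (1 : ℝ) • (a - c) = c := by simp
  have e2 : a - (1 / 2 : ℝ) • (a - c) = (1 / 2 : ℝ) • (a + c) := by module
  rw [e1] at h1
  rw [e2] at h2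
  linarith

/-! ### Dependence of the fit on the response -/

section Estimate

variable {n p : ℕ} {X : Matrix (Fin n) (Fin p) ℝ} {lam mu : ℝ}

/-- Strong convexity of the criterion in the fit, at the midpoint. -/
theorem criterion_midpoint_le (hlam : 0 ≤ lam) (hmu : 0 ≤ mu) (y : Fin n → ℝ)
    (b c : Fin p → ℝ) :
    criterion X lam mu y ((1 / 2 : ℝ) • (b + c)) ≤
      (criterion X lam mu y b + criterion X lam mu y c) / 2
        - empNormSq (X *ᵥ b - X *ᵥ c) / 4 := by
  have hres : y - X *ᵥ ((1 / 2 : ℝ) • (b + c)) =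
      (1 / 2 : ℝ) • ((y - X *ᵥ b) + (y - X *ᵥ c)) := by
    rw [Matrix.mulVec_smul, Matrix.mulVec_add]
    module
  have habs : ∑ j, |((1 / 2 : ℝ) • (b + c)) j| ≤ (∑ j, |b j| + ∑ j, |c j|) / 2 := by
    rw [← Finset.sum_add_distrib, Finset.sum_div]
    refine Finset.sum_le_sum fun j _ => ?_
    simp only [Pi.smul_apply, Pi.add_apply, smul_eq_mul, abs_mul]
    rw [abs_of_pos (by norm_num : (0 : ℝ) < 1 / 2)]
    linarith [abs_add_le (b j) (c j)]
  have hsq := empNormSq_midpoint (y - X *ᵥ b) (y - X *ᵥ c)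
  have hneg : empNormSq (y - X *ᵥ b - (y - X *ᵥ c)) = empNormSq (X *ᵥ b - X *ᵥ c) := by
    unfold empNormSq
    congr 1
    refine Finset.sum_congr rfl fun i _ => ?_
    simp only [Pi.sub_apply]
    ring
  rw [hneg] at hsq
  unfold criterion
  rw [hres, hsq]
  have h1 := mul_le_mul_of_nonneg_left habs hlam
  have h2 := mul_le_mul_of_nonneg_left (fusion_midpoint_le b c) hmu
  linarith

theorem IsEstimate.empNormSq_sub_le (hlam : 0 ≤ lam) (hmu : 0 ≤ mu) {y : Fin n → ℝ}
    {b : Fin p → ℝ} (hb : IsEstimate X lam mu y b) (c : Fin p → ℝ) :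
    empNormSq (X *ᵥ b - X *ᵥ c) / 2 ≤ criterion X lam mu y c - criterion X lam mu y b := by
  linarith [hb ((1 / 2 : ℝ) • (b + c)), criterion_midpoint_le (X := X) hlam hmu y b c]

/-- The fit is a Lipschitz function of the response: the two strong convexity inequalities for
the estimates at `y` and `y'`, added up. -/
theorem IsEstimate.sum_sq_fit_sub_le (hn : 0 < n) (hlam : 0 ≤ lam) (hmu : 0 ≤ mu)
    {y y' : Fin n → ℝ} {b b' : Fin p → ℝ} (hb : IsEstimate X lam mu y b)
    (hb' : IsEstimate X lam mu y' b') :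
    ∑ i, ((X *ᵥ b) i - (X *ᵥ b') i) ^ 2 ≤ 4 * ∑ i, (y i - y' i) ^ 2 := by
  have h1 := hb.empNormSq_sub_le hlam hmu b'
  have h2 := hb'.empNormSq_sub_le hlam hmu b
  unfold criterion empNormSq at h1 h2
  have hn' : (0 : ℝ) < n := by exact_mod_cast hn
  have key : (n : ℝ)⁻¹ * (∑ i, ((X *ᵥ b) i - (X *ᵥ b') i) ^ 2) ≤
      (n : ℝ)⁻¹ * ∑ i, 2 * ((y i - y' i) * ((X *ᵥ b) i - (X *ᵥ b') i)) := by
    have e1 : ∑ i, ((X *ᵥ b' - X *ᵥ b) i) ^ 2 = ∑ i, ((X *ᵥ b - X *ᵥ b') i) ^ 2 :=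
      Finset.sum_congr rfl fun i _ => by simp only [Pi.sub_apply]; ring
    have e2 : ∑ i, 2 * ((y i - y' i) * ((X *ᵥ b) i - (X *ᵥ b') i)) =
        ∑ i, (y - X *ᵥ b') i ^ 2 - ∑ i, (y - X *ᵥ b) i ^ 2
          + ∑ i, (y' - X *ᵥ b) i ^ 2 - ∑ i, (y' - X *ᵥ b') i ^ 2 := by
      simp only [← Finset.sum_add_distrib, ← Finset.sum_sub_distrib]
      refine Finset.sum_congr rfl fun i _ => ?_
      simp only [Pi.sub_apply]
      ring
    rw [e1] at h2
    rw [e2]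
    simp only [Pi.sub_apply] at h1 h2 ⊢
    linarith
  have key' := le_of_mul_le_mul_left key (inv_pos.2 hn')
  -- `2ab ≤ 2a² + b²/2`, so that half of the left-hand side is absorbed.
  have hyoung : ∑ i, 2 * ((y i - y' i) * ((X *ᵥ b) i - (X *ᵥ b') i)) ≤
      ∑ i, (2 * (y i - y' i) ^ 2 + ((X *ᵥ b) i - (X *ᵥ b') i) ^ 2 / 2) :=
    Finset.sum_le_sum fun i _ => by
      nlinarith [sq_nonneg (2 * (y i - y' i) - ((X *ᵥ b) i - (X *ᵥ b') i))]
  rw [Finset.sum_add_distrib, ← Finset.sum_div,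
    ← Finset.mul_sum _ (fun i => (y i - y' i) ^ 2)] at hyoung
  linarith

/-- Distances on `Fin n → ℝ` are sup distances, which costs a factor `√n ≤ n` over the Euclidean
estimate `IsEstimate.sum_sq_fit_sub_le`. -/
theorem lipschitzWith_fit (hn : 0 < n) (hlam : 0 ≤ lam) (hmu : 0 ≤ mu)
    {βhat : (Fin n → ℝ) → Fin p → ℝ} (hβ : ∀ y, IsEstimate X lam mu y (βhat y)) :
    LipschitzWith (2 * n : ℝ≥0) fun y => X *ᵥ βhat y := by
  refine LipschitzWith.of_dist_le_mul fun y y' => ?_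
  have hn1 : (1 : ℝ) ≤ n := by exact_mod_cast hn
  rw [dist_pi_le_iff (by positivity)]
  intro i
  have h := (hβ y).sum_sq_fit_sub_le hn hlam hmu (hβ y')
  have hi : ((X *ᵥ βhat y) i - (X *ᵥ βhat y') i) ^ 2 ≤
      ∑ i, ((X *ᵥ βhat y) i - (X *ᵥ βhat y') i) ^ 2 :=
    Finset.single_le_sum (f := fun i => ((X *ᵥ βhat y) i - (X *ᵥ βhat y') i) ^ 2)
      (fun _ _ => sq_nonneg _) (Finset.mem_univ i)
  have hsum : ∑ i, (y i - y' i) ^ 2 ≤ n * dist y y' ^ 2 := by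
    calc ∑ i, (y i - y' i) ^ 2 ≤ ∑ _i : Fin n, dist y y' ^ 2 :=
          Finset.sum_le_sum fun i _ => by
            rw [← sq_abs, ← Real.dist_eq]
            gcongr
            exact dist_le_pi_dist y y' i
      _ = n * dist y y' ^ 2 := by simp
  rw [Real.dist_eq]
  refine abs_le_of_sq_le_sq ?_ (by positivity)
  push_cast
  nlinarith [sq_nonneg (dist y y'), mul_nonneg (sub_nonneg.2 hn1) (sq_nonneg (dist y y'))]

/-! ### The criterion along directions supported in the active set -/

/-- The directional derivative of the criterion at `b` along a direction `v` that vanishes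
wherever `b` does. -/
noncomputable def slope (X : Matrix (Fin n) (Fin p) ℝ) (lam mu : ℝ) (y : Fin n → ℝ)
    (b v : Fin p → ℝ) : ℝ :=
  -(2 * (n : ℝ)⁻¹ * ((y - X *ᵥ b) ⬝ᵥ (X *ᵥ v))) + lam * ∑ j, (SignType.sign (b j) : ℝ) * v j
    + mu * (2 * ((diffMatrix p *ᵥ b) ⬝ᵥ (diffMatrix p *ᵥ v)))

theorem abs_add_mul_eq_of_abs_le {b v t : ℝ} (h : |t * v| ≤ |b|) (h0 : b = 0 → v = 0) :
    |b + t * v| = |b| + t * (SignType.sign b * v) := by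
  rcases lt_trichotomy b 0 with hb | hb | hb
  · rw [abs_of_neg hb] at h
    rw [abs_of_neg hb, abs_of_nonpos (by linarith [le_abs_self (t * v)])]
    simp [hb]
    ring
  · simp [hb, h0 hb]
  · rw [abs_of_pos hb] at h
    rw [abs_of_pos hb, abs_of_nonneg (by linarith [neg_abs_le (t * v)])]
    simp [hb]

/-- Along directions supported in the active set the criterion is quadratic near `b`, since the
signs of the active coefficients do not change. -/
theorem exists_criterion_add_smul_eq (y : Fin n → ℝ) {b v : Fin p → ℝ}
    (hv : ∀ j, b j = 0 → v j = 0) :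
    ∃ δ > 0, ∀ t : ℝ, |t| ≤ δ → criterion X lam mu y (b + t • v) =
      criterion X lam mu y b + t * slope X lam mu y b v
        + t ^ 2 * (empNormSq (X *ᵥ v) + mu * fusion v) := by
  have hloc : ∀ᶠ t in nhds (0 : ℝ), ∀ j, |t * v j| ≤ |b j| := by
    rw [Filter.eventually_all]
    intro j
    by_cases hbj : b j = 0
    · simp [hv j hbj]
    · have hc : Filter.Tendsto (fun t : ℝ => |t * v j|) (nhds 0) (nhds |0 * v j|) :=
        Continuous.tendsto (by fun_prop) 0
      rw [zero_mul, abs_zero] at hc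
      exact (hc.eventually_lt_const (abs_pos.2 hbj)).mono fun t ht => ht.le
  obtain ⟨δ, hδ, hball⟩ := Metric.eventually_nhds_iff.1 hloc
  refine ⟨δ / 2, by positivity, fun t ht => ?_⟩
  have habs := hball (y := t) (by rw [Real.dist_eq, sub_zero]; linarith)
  have h1 : ∑ j, |(b + t • v) j| = ∑ j, |b j| + t * ∑ j, (SignType.sign (b j) : ℝ) * v j := by
    rw [Finset.mul_sum, ← Finset.sum_add_distrib]
    exact Finset.sum_congr rfl fun j _ => abs_add_mul_eq_of_abs_le (habs j) (hv j)
  have h2 : y - X *ᵥ (b + t • v) = (y - X *ᵥ b) - t • (X *ᵥ v) := by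
    rw [Matrix.mulVec_add, Matrix.mulVec_smul]
    abel
  unfold criterion slope
  rw [h1, h2, empNormSq_sub_smul, fusion_add_smul]
  ring

theorem eq_zero_of_forall_add_sq_nonneg {s q δ : ℝ} (hδ : 0 < δ)
    (h : ∀ t : ℝ, |t| ≤ δ → 0 ≤ t * s + t ^ 2 * q) : s = 0 := by
  have hmin : IsLocalMin (fun t : ℝ => t * s + t ^ 2 * q) 0 := by
    filter_upwards [Metric.ball_mem_nhds (0 : ℝ) hδ] with t ht
    have := h t (by simpa using (Metric.mem_ball.1 ht).le)
    simpa using this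
  have hd : HasDerivAt (fun t : ℝ => t * s + t ^ 2 * q) s 0 := by
    refine (((hasDerivAt_id (0 : ℝ)).mul_const s).add
      (((hasDerivAt_id (0 : ℝ)).pow 2).mul_const q)).congr_deriv ?_
    simp
  exact hmin.hasDerivAt_eq_zero hd

theorem IsEstimate.slope_eq_zero {y : Fin n → ℝ} {b v : Fin p → ℝ}
    (hb : IsEstimate X lam mu y b) (hv : ∀ j, b j = 0 → v j = 0) :
    slope X lam mu y b v = 0 := by
  obtain ⟨δ, hδ, h⟩ := exists_criterion_add_smul_eq (X := X) (lam := lam) (mu := mu) y hv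
  refine eq_zero_of_forall_add_sq_nonneg hδ
    (q := empNormSq (X *ᵥ v) + mu * fusion v) fun t ht => ?_
  linarith [h t ht, hb (b + t • v)]

end Estimate

/-! ### The Gram matrix of the active set -/

section ActiveSet

variable {n p : ℕ} {X : Matrix (Fin n) (Fin p) ℝ} {lam mu : ℝ} {A : Finset (Fin p)}

theorem sum_coe_eq_sum_of_support {f b : Fin p → ℝ} (hb : ∀ j, j ∉ A → b j = 0) :
    ∑ a : A, f a * b a = ∑ j, f j * b j := by
  rw [Finset.sum_coe_sort A fun j => f j * b j]
  exact Finset.sum_subset (Finset.subset_univ A) fun j _ hj => by rw [hb j hj, mul_zero]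

theorem colSub_mulVec {b : Fin p → ℝ} (hb : ∀ j, j ∉ A → b j = 0) :
    colSub X A *ᵥ (fun a : A => b a) = X *ᵥ b :=
  funext fun i => sum_coe_eq_sum_of_support (f := X i) hb

theorem activeGram_mulVec {b : Fin p → ℝ} (hb : ∀ j, j ∉ A → b j = 0) (a : A) :
    (activeGram X mu A *ᵥ fun a : A => b a) a =
      (Xᵀ *ᵥ (X *ᵥ b)) a + n * mu * ((diffMatrix p)ᵀ *ᵥ (diffMatrix p *ᵥ b)) a := by
  have h : ((Jtilde p).submatrix Subtype.val Subtype.val *ᵥ fun a : A => b a) a =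
      (Jtilde p *ᵥ b) a := sum_coe_eq_sum_of_support (f := Jtilde p a) hb
  rw [activeGram, Matrix.add_mulVec, Matrix.smul_mulVec, ← Matrix.mulVec_mulVec,
    colSub_mulVec hb, Pi.add_apply, Pi.smul_apply, h, Jtilde, ← Matrix.mulVec_mulVec]
  rfl

theorem mem_activeSet {b : Fin p → ℝ} {j : Fin p} : j ∈ activeSet b ↔ b j ≠ 0 := by
  simp [activeSet]

theorem eq_zero_of_notMem_activeSet {b : Fin p → ℝ} (j : Fin p) (hj : j ∉ activeSet b) :
    b j = 0 := by
  simpa [mem_activeSet] using hj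

/-- The stationarity conditions on the active set. -/
theorem IsEstimate.activeGram_mulVec_eq (hn : 0 < n) {y : Fin n → ℝ} {b : Fin p → ℝ}
    (hb : IsEstimate X lam mu y b) :
    (activeGram X mu (activeSet b) *ᵥ fun a : activeSet b => b a) =
      (colSub X (activeSet b))ᵀ *ᵥ y -
        fun a : activeSet b => (n : ℝ) * lam / 2 * (SignType.sign (b a) : ℝ) := by
  ext a
  have hn' : (n : ℝ) ≠ 0 := by exact_mod_cast hn.ne'
  have hs := hb.slope_eq_zero (v := Pi.single (a : Fin p) 1) fun j hj => by
    have : j ≠ a := fun h => mem_activeSet.1 a.2 (h ▸ hj)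
    simp [this]
  have hX : (y - X *ᵥ b) ⬝ᵥ (X *ᵥ Pi.single (a : Fin p) 1) = (Xᵀ *ᵥ (y - X *ᵥ b)) a := by
    rw [Matrix.mulVec_single_one, Matrix.mulVec, dotProduct_comm]
    rfl
  have hD : (diffMatrix p *ᵥ b) ⬝ᵥ (diffMatrix p *ᵥ Pi.single (a : Fin p) 1) =
      ((diffMatrix p)ᵀ *ᵥ (diffMatrix p *ᵥ b)) a := by
    rw [Matrix.mulVec_single_one]
    exact dotProduct_comm _ _
  have hsum : ∑ j, (SignType.sign (b j) : ℝ) * (Pi.single (a : Fin p) (1 : ℝ) : Fin p → ℝ) j =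
      (SignType.sign (b a) : ℝ) := by
    simp [Pi.single_apply]
  rw [slope, hX, hD, hsum, Matrix.mulVec_sub, Pi.sub_apply] at hs
  rw [activeGram_mulVec eq_zero_of_notMem_activeSet, Pi.sub_apply]
  have hy : ((colSub X (activeSet b))ᵀ *ᵥ y) a = (Xᵀ *ᵥ y) a := rfl
  rw [hy]
  field_simp at hs
  linarith

/-- The smoothing matrix `X_A G_A⁻¹ X_A'` whose trace is `dfHat`. -/
noncomputable def hatMatrix (X : Matrix (Fin n) (Fin p) ℝ) (mu : ℝ) (A : Finset (Fin p)) :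
    Matrix (Fin n) (Fin n) ℝ :=
  colSub X A * (activeGram X mu A)⁻¹ * (colSub X A)ᵀ

/-- The constant term of the fit, as an affine function of the response, on the set of responses
with active set `A` and signs `s`. -/
noncomputable def shrinkage (X : Matrix (Fin n) (Fin p) ℝ) (lam mu : ℝ) (A : Finset (Fin p))
    (s : Fin p → SignType) : Fin n → ℝ :=
  -((colSub X A * (activeGram X mu A)⁻¹) *ᵥ fun a : A => (n : ℝ) * lam / 2 * (s a : ℝ))

/-- On the set of responses with a given invertible Gram matrix and given signs, the fit is affine
in the response, with linear part the smoothing matrix. -/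
theorem IsEstimate.fit_eq (hn : 0 < n) {y : Fin n → ℝ} {b : Fin p → ℝ}
    (hb : IsEstimate X lam mu y b) (hG : IsUnit (activeGram X mu (activeSet b))) :
    X *ᵥ b = hatMatrix X mu (activeSet b) *ᵥ y +
      shrinkage X lam mu (activeSet b) fun j => SignType.sign (b j) := by
  have h := congrArg ((activeGram X mu (activeSet b))⁻¹ *ᵥ ·) (hb.activeGram_mulVec_eq hn)
  rw [Matrix.mulVec_mulVec, Matrix.nonsing_inv_mul _ ((Matrix.isUnit_iff_isUnit_det _).1 hG),
    Matrix.one_mulVec] at h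
  rw [← colSub_mulVec (A := activeSet b) eq_zero_of_notMem_activeSet, h, hatMatrix, shrinkage,
    Matrix.mulVec_mulVec, Matrix.mulVec_sub, Matrix.mulVec_mulVec, sub_eq_add_neg]

/-- A vector in the kernel of `G_A` is killed by the design and, unless `mu = 0`, by the
differences. -/
theorem mulVec_eq_zero_of_activeGram_mulVec_eq_zero (hn : 0 < n) (hmu : 0 ≤ mu) {v : Fin p → ℝ}
    (hv : ∀ j, j ∉ A → v j = 0) (h : (activeGram X mu A *ᵥ fun a : A => v a) = 0) :
    X *ᵥ v = 0 ∧ mu * fusion v = 0 := by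
  -- The quadratic form of `G_A` at `v` is a sum of two nonnegative terms.
  have hq : (∑ i, (X *ᵥ v) i ^ 2) + n * (mu * fusion v) = 0 := by
    have e : ∀ {m : ℕ} (M : Matrix (Fin m) (Fin p) ℝ),
        ∑ j, (Mᵀ *ᵥ (M *ᵥ v)) j * v j = ∑ i, (M *ᵥ v) i ^ 2 := fun M => by
      change (Mᵀ *ᵥ (M *ᵥ v)) ⬝ᵥ v = _
      rw [Matrix.mulVec_transpose, ← Matrix.dotProduct_mulVec]
      simp only [dotProduct, sq]
    have h0 : ∑ a : A, ((Xᵀ *ᵥ (X *ᵥ v)) a +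
        n * mu * ((diffMatrix p)ᵀ *ᵥ (diffMatrix p *ᵥ v)) a) * v a = 0 :=
      Finset.sum_eq_zero fun a _ => by
        rw [← activeGram_mulVec hv a, h, Pi.zero_apply, zero_mul]
    rw [sum_coe_eq_sum_of_support
      (f := fun j => (Xᵀ *ᵥ (X *ᵥ v)) j +
        n * mu * ((diffMatrix p)ᵀ *ᵥ (diffMatrix p *ᵥ v)) j) hv] at h0
    simp only [add_mul, Finset.sum_add_distrib, mul_assoc, ← Finset.mul_sum, e,
      ← fusion_eq_sum_sq_diffMatrix_mulVec] at h0
    exact h0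
  have hn' : (0 : ℝ) < n := by exact_mod_cast hn
  have h1 : 0 ≤ ∑ i, (X *ᵥ v) i ^ 2 := by positivity
  have h2 : 0 ≤ mu * fusion v := mul_nonneg hmu (fusion_nonneg v)
  have h3 : mu * fusion v = 0 := by nlinarith
  have h4 : ∑ i, (X *ᵥ v) i ^ 2 = 0 := by simpa [h3] using hq
  refine ⟨funext fun i => ?_, h3⟩
  have := (Finset.sum_eq_zero_iff_of_nonneg fun i _ => sq_nonneg ((X *ᵥ v) i)).1 h4 i
    (Finset.mem_univ i)
  simpa using this

/-- If `G_A` is singular, the criterion is constant near `b` along a vector of its kernel, so `b`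
is not the only minimizer. -/
theorem IsEstimate.isUnit_activeGram (hn : 0 < n) (hmu : 0 ≤ mu) {y : Fin n → ℝ}
    {b : Fin p → ℝ} (hb : IsEstimate X lam mu y b)
    (huniq : ∀ b', IsEstimate X lam mu y b' → b' = b) :
    IsUnit (activeGram X mu (activeSet b)) := by
  rw [Matrix.isUnit_iff_isUnit_det, isUnit_iff_ne_zero]
  intro hdet
  -- A kernel vector of `G_A`, extended by zero to all indices.
  obtain ⟨w, hw0, hw⟩ := Matrix.exists_mulVec_eq_zero_iff.2 hdet
  classical
  let v : Fin p → ℝ := fun j => if h : j ∈ activeSet b then w ⟨j, h⟩ else 0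
  have hvw : (fun a : activeSet b => v a) = w := funext fun a => by simp [v]
  have hv : ∀ j, j ∉ activeSet b → v j = 0 := fun j hj => by simp [v, hj]
  obtain ⟨hX, hF⟩ := mulVec_eq_zero_of_activeGram_mulVec_eq_zero (X := X) (mu := mu) hn hmu hv
    (by rw [hvw, hw])
  have hv' : ∀ j, b j = 0 → v j = 0 := fun j hj => hv j fun h => mem_activeSet.1 h hj
  obtain ⟨δ, hδ, h⟩ := exists_criterion_add_smul_eq (X := X) (lam := lam) (mu := mu) y hv'
  have hδ' := h δ (abs_of_pos hδ).le
  rw [hb.slope_eq_zero hv', hX, hF] at hδ'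
  have hzero : empNormSq (0 : Fin n → ℝ) = 0 := by simp [empNormSq]
  rw [hzero, mul_zero, add_zero, add_zero, mul_zero, add_zero] at hδ'
  have hbv := huniq (b + δ • v) fun β => hδ'.le.trans (hb β)
  have hv0 : v = 0 := by
    have : δ • v = 0 := by simpa using hbv
    exact (smul_eq_zero.1 this).resolve_left hδ.ne'
  exact hw0 (by rw [← hvw, hv0]; rfl)

end ActiveSet

end SLasso

/-! ### Unbiasedness -/

namespace SLasso

variable {n p : ℕ} {X : Matrix (Fin n) (Fin p) ℝ} {lam mu : ℝ}

theorem sum_hatMatrix_mulVec_single (A : Finset (Fin p)) :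
    ∑ i, (hatMatrix X mu A *ᵥ Pi.single i 1) i = dfHat X mu A := by
  simp only [Matrix.mulVec_single_one]
  rfl

/-- The estimate of the degrees of freedom is almost everywhere the divergence of the fit. No
regularity of the selection `βhat` is needed: there are finitely many affine maps with which the
fit can agree. -/
theorem ae_dfHat_eq_sum_lineDeriv (hn : 0 < n) (hlam : 0 ≤ lam) (hmu : 0 ≤ mu)
    {βhat : (Fin n → ℝ) → Fin p → ℝ} (hβ : ∀ y, IsEstimate X lam mu y (βhat y)) :
    ∀ᵐ y, IsUnit (activeGram X mu (activeSet (βhat y))) →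
      dfHat X mu (activeSet (βhat y)) =
        ∑ i, lineDeriv ℝ (fun z => (X *ᵥ βhat z) i) y (Pi.single i 1) := by
  have hlip := lipschitzWith_fit hn hlam hmu hβ
  have hall : ∀ᵐ y : Fin n → ℝ, ∀ (A : Finset (Fin p)) (s : Fin p → SignType),
      X *ᵥ βhat y = (hatMatrix X mu A).mulVecLin.toContinuousLinearMap y
        + shrinkage X lam mu A s →
      HasFDerivAt (fun z => X *ᵥ βhat z) (hatMatrix X mu A).mulVecLin.toContinuousLinearMap y :=
    ae_all_iff.2 fun A => ae_all_iff.2 fun s => hlip.ae_fderiv_eq_of_eq_affine _ _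
  filter_upwards [hall] with y hy hG
  have hd := hy _ _ ((hβ y).fit_eq hn hG)
  rw [← sum_hatMatrix_mulVec_single]
  refine Finset.sum_congr rfl fun i _ => ?_
  exact ((hasFDerivAt_pi'.1 hd i).hasLineDerivAt (Pi.single i 1)).lineDeriv.symm

end SLasso

theorem mainTheorem7 {Ω : Type*} [MeasurableSpace Ω] (P : Measure Ω) [IsProbabilityMeasure P]
    (n p : ℕ) (hn : 0 < n) (X : Matrix (Fin n) (Fin p) ℝ) (βstar : Fin p → ℝ)
    (σ : ℝ≥0) (hσ : 0 < σ) (ε : Fin n → Ω → ℝ)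
    (hε : ∀ i, HasLaw (ε i) (gaussianReal 0 (σ ^ 2)) P) (hind : iIndepFun ε P)
    (lam mu : ℝ) (hlam : 0 < lam) (hmu : 0 ≤ mu) :
    (∀ (y : Fin n → ℝ) (b : Fin p → ℝ), SLasso.IsEstimate X lam mu y b →
      (∀ b' : Fin p → ℝ, SLasso.IsEstimate X lam mu y b' → b' = b) →
        IsUnit (SLasso.activeGram X mu (SLasso.activeSet b))) ∧
    ∀ βhat : (Fin n → ℝ) → (Fin p → ℝ),
      (∀ y, SLasso.IsEstimate X lam mu y (βhat y)) →
      (∀ᵐ ω ∂P, IsUnit (SLasso.activeGram X mu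
        (SLasso.activeSet (βhat (SLasso.response X βstar ε ω))))) →
      (∀ i, MemLp (fun ω => (X *ᵥ βhat (SLasso.response X βstar ε ω)) i) 2 P) ∧
      Integrable (fun ω => SLasso.dfHat X mu
        (SLasso.activeSet (βhat (SLasso.response X βstar ε ω)))) P ∧
      ∫ ω, SLasso.dfHat X mu
          (SLasso.activeSet (βhat (SLasso.response X βstar ε ω))) ∂P =
        SLasso.effectiveDF P σ (SLasso.response X βstar ε)
          (fun ω => X *ᵥ βhat (SLasso.response X βstar ε ω)) := by
  refine ⟨fun y b hb huniq => hb.isUnit_activeGram hn hmu huniq, fun βhat hβ hG => ?_⟩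
  have hlip := SLasso.lipschitzWith_fit hn hlam.le hmu hβ
  have hσ2 : σ ^ 2 ≠ 0 := (pow_pos hσ 2).ne'
  set γ : Measure (Fin n → ℝ) := Measure.pi fun _ => gaussianReal 0 (σ ^ 2) with hγ
  have hεm : ∀ i, AEMeasurable (ε i) P := fun i => (hε i).aemeasurable
  have hlaw : HasLaw (fun ω i => ε i ω) γ P :=
    ⟨aemeasurable_pi_lambda _ hεm, by
      rw [(iIndepFun_iff_map_fun_eq_pi_map hεm).1 hind, hγ]
      simp only [(hε _).map_eq]⟩
  have hresp : SLasso.response X βstar ε = fun ω => X *ᵥ βstar + fun i => ε i ω := rfl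
  -- The coordinates of the fit as Lipschitz functions of the noise.
  let F : Fin n → (Fin n → ℝ) → ℝ := fun i z => (X *ᵥ βhat (X *ᵥ βstar + z)) i
  have hF : ∀ i, LipschitzWith (2 * n : ℝ≥0) (F i) := fun i => by
    refine LipschitzWith.of_dist_le_mul fun z w => ?_
    refine (dist_le_pi_dist _ _ i).trans ((hlip.dist_le_mul _ _).trans ?_)
    rw [dist_add_left]
  have hline : ∀ i z, lineDeriv ℝ (F i) z (Pi.single i 1) =
      lineDeriv ℝ (fun y => (X *ᵥ βhat y) i) (X *ᵥ βstar + z) (Pi.single i 1) := fun i z => by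
    simp only [lineDeriv, F, add_assoc]
  have hdiv : ∀ᵐ ω ∂P, SLasso.dfHat X mu
      (SLasso.activeSet (βhat (SLasso.response X βstar ε ω))) =
        ∑ i, lineDeriv ℝ (F i) (fun j => ε j ω) (Pi.single i 1) := by
    have hac : γ ≪ volume :=
      pi_absolutelyContinuous fun _ => (gaussianReal_absolutelyContinuous 0 hσ2)
    have h1 := SLasso.ae_dfHat_eq_sum_lineDeriv hn hlam.le hmu hβ
    have h2 := hac.ae_le ((measurePreserving_add_left volume (X *ᵥ βstar)
      ).quasiMeasurePreserving.ae h1)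
    rw [← hlaw.map_eq] at h2
    filter_upwards [ae_of_ae_map hlaw.aemeasurable h2, hG] with ω hω hGω
    simp only [hline]
    exact hω hGω
  have hint : ∀ i, Integrable (fun z => lineDeriv ℝ (F i) z (Pi.single i 1)) γ := fun i =>
    integrable_lineDeriv_of_lipschitz (hF i) _ γ
  have hintP : ∀ i, Integrable
      (fun ω => lineDeriv ℝ (F i) (fun j => ε j ω) (Pi.single i 1)) P := fun i => by
    have := hint i
    rw [← hlaw.map_eq] at this
    exact this.comp_aemeasurable hlaw.aemeasurable
  have hfit : ∀ i, MemLp (fun ω => F i (fun j => ε j ω)) 2 P := fun i => by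
    have := (hF i).memLp_comp (memLp_id_pi_gaussianReal n (σ ^ 2))
    rw [← hγ, ← hlaw.map_eq] at this
    exact this.comp_of_map hlaw.aemeasurable
  refine ⟨hfit, (integrable_finsetSum _ fun i _ => hintP i).congr (hdiv.mono fun ω h => h.symm),
    ?_⟩
  have hε2 : ∀ i, MemLp (ε i) 2 P := fun i => by
    have : MemLp id 2 (P.map (ε i)) := by
      rw [(hε i).map_eq]
      exact memLp_id_gaussianReal' 2 (by simp)
    exact this.comp_of_map (hεm i)
  -- Stein's identity in the noise variables; the mean of the response drops out.
  have hcov : ∀ i, cov[fun ω => SLasso.response X βstar ε ω i,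
      fun ω => (X *ᵥ βhat (SLasso.response X βstar ε ω)) i; P] =
        (σ : ℝ) ^ 2 * ∫ ω, lineDeriv ℝ (F i) (fun j => ε j ω) (Pi.single i 1) ∂P := fun i => by
    have hmean : ∫ ω, ε i ω ∂P = 0 := by
      rw [(hε i).integral_eq, integral_id_gaussianReal]
    have hstein := integral_eval_mul_pi_gaussianReal_of_lipschitz (hF i) hσ2 i
    rw [← hγ, ← hlaw.integral_comp, ← hlaw.integral_comp] at hstein
    · change cov[fun ω => (X *ᵥ βstar) i + ε i ω, fun ω => F i (fun j => ε j ω); P] = _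
      rw [covariance_const_add_left ((hε2 i).integrable one_le_two),
        covariance_eq_sub (hε2 i) (hfit i), hmean, zero_mul, sub_zero]
      simpa [Function.comp_def] using hstein
    · exact (hint i).aestronglyMeasurable
    · exact ((measurable_pi_apply i).mul (hF i).continuous.measurable).aestronglyMeasurable
  rw [integral_congr_ae hdiv, integral_finsetSum _ fun i _ => hintP i, SLasso.effectiveDF,
    Finset.mul_sum]
  refine Finset.sum_congr rfl fun i _ => ?_
  rw [hcov i]
  have : (σ : ℝ) ≠ 0 := by exact_mod_cast hσ.ne'
  field_simp
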